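/- Let $d\in\mathbb N$ and let $\nu$ be a finite non-negative Borel measure on $[0,\infty)$ with $\operatorname{supp}(\nu)\neq\{0\}$. Let $k$ be the radial kernel on $\mathbb R^d$ given by $$k(x,y)=\int_0^\infty e^{-t\|x-y\|_2^2}\,d\nu(t),\qquad x,y\in\mathbb R^d,$$ let $\mathcal H_k$ be its reproducing kernel Hilbert space, and for a Borel probability measure $P$ on $\mathbb R^d$ let $\mu_k(P)=\int k(\cdot,x)\,dP(x)\in\mathcal H_k$ (a Bochner integral) be its kernel mean embedding. Let $\mathcal P$ be the set of Borel probability measures on $\mathbb R^d$ that have an infinitely continuously differentiable density with respect to Lebesgue measure. Suppose that $0<t_0\le t_1<\infty$ and $0<\beta<\infty$ satisfy $\nu([t_0,t_1])\ge\beta$, put $Z_\nu=\nu([0,\infty))$, and let $n\in\mathbb N$ satisfy $$n\ \ge\ 24\,\frac{t_1Z_\nu}{\beta t_0}.$$ Then $$\inf_{\hat\theta_n}\ \sup_{P\in\mathcal P}\ P^n\left\{\|\hat\theta_n-\mu_k(P)\|_{\mathcal H_k}\ \ge\ \frac1{50}\sqrt{\frac1{2n}\cdot\frac{\beta t_0}{t_1e}\left(1-\frac2{2+d}\right)}\right\}\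 \ge\ \frac15,$$ where $P^n$ is the law of an i.i.d. sample of size $n$ from $P$ and the infimum is over all estimators, i.e. all measurable maps $\hat\theta_n:(\mathbb R^d)^n\to\mathcal H_k$. -/

import Mathlib

open MeasureTheory
open scoped NNReal ENNReal ContDiff

noncomputable section

/-- The radial function `k(x, y) = ∫_{[0, ∞)} exp (-t ‖x - y‖₂²) dν(t)` on `ℝᵈ`. -/
def radialKernel {d : ℕ} (ν : Measure ℝ≥0) (x y : EuclideanSpace ℝ (Fin d)) : ℝ :=
  ∫ t : ℝ≥0, Real.exp (-((t : ℝ) * ‖x - y‖ ^ 2)) ∂ν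

/-- The canonical feature map `x ↦ k(·, x)` of a real reproducing kernel Hilbert space. -/
def featureMap {X : Type*} (H : Type*) [NormedAddCommGroup H] [InnerProductSpace ℝ H]
    [CompleteSpace H] [RKHS ℝ H X ℝ] (x : X) : H :=
  RKHS.kerFun H x 1

/-- The kernel mean embedding `μ_k(P) = ∫ k(·, x) dP(x)`, a Bochner integral in `H`. -/
def kernelMeanEmbedding {X : Type*} [MeasurableSpace X] (H : Type*) [NormedAddCommGroup H]
    [InnerProductSpace ℝ H] [CompleteSpace H] [RKHS ℝ H X ℝ] (P : Measure X) : H :=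
  ∫ x, featureMap H x ∂P

/-- The Borel probability measures on `ℝᵈ` that have an infinitely differentiable density with
respect to Lebesgue measure. -/
def smoothDensityLaws (d : ℕ) : Set (Measure (EuclideanSpace ℝ (Fin d))) :=
  {P | IsProbabilityMeasure P ∧ ∃ p : EuclideanSpace ℝ (Fin d) → ℝ,
    ContDiff ℝ ∞ p ∧ (∀ x, 0 ≤ p x) ∧ P = volume.withDensity (fun x => ENNReal.ofReal (p x))}

/-- The minimax probability `inf_θ̂ sup_{P ∈ C} Pⁿ {‖θ̂(X₁, …, Xₙ) - θ(P)‖ ≥ s}`. The infimum is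
over all estimators, that is, all Borel measurable maps of the sample into `H`. -/
def minimaxProbability {X H : Type*} [MeasurableSpace X] [NormedAddCommGroup H]
    [MeasurableSpace H] (C : Set (Measure X)) (θ : Measure X → H) (n : ℕ) (s : ℝ) : ℝ≥0∞ :=
  ⨅ est : {f : (Fin n → X) → H // Measurable f}, ⨆ P ∈ C,
    (Measure.pi fun _ : Fin n => P) {x | s ≤ ‖est.1 x - θ P‖}

theorem integrable_radialKernel {d : ℕ} (ν : Measure ℝ≥0) [IsFiniteMeasure ν]
    (x y : EuclideanSpace ℝ (Fin d)) :
    Integrable (fun t : ℝ≥0 => Real.exp (-((t : ℝ) * ‖x - y‖ ^ 2))) ν := by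
  refine Integrable.of_bound (by fun_prop) 1 (ae_of_all _ fun t => ?_)
  rw [Real.norm_eq_abs, abs_of_pos (Real.exp_pos _), Real.exp_le_one_iff]
  have := t.2
  have : 0 ≤ (t : ℝ) * ‖x - y‖ ^ 2 := by positivity
  linarith

theorem exp_neg_eq_integral_cos {d : ℕ} (t : ℝ≥0) (x y : EuclideanSpace ℝ (Fin d)) :
    Real.exp (-((t : ℝ) * ‖x - y‖ ^ 2)) =
      ∫ w, Real.cos (inner ℝ w (Real.sqrt (2 * t) • (x - y)))
        ∂(ProbabilityTheory.stdGaussian (EuclideanSpace ℝ (Fin d))) := by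
  have h := ProbabilityTheory.charFun_stdGaussian (E := EuclideanSpace ℝ (Fin d))
    (Real.sqrt (2 * t) • (x - y))
  rw [charFun_apply] at h
  have h2 := congrArg Complex.re h
  rw [← RCLike.re_eq_complex_re, ← integral_re] at h2
  · have e : ∀ w : EuclideanSpace ℝ (Fin d),
        RCLike.re (Complex.exp ((inner ℝ w (Real.sqrt (2 * t) • (x - y)) : ℝ) * Complex.I)) =
          Real.cos (inner ℝ w (Real.sqrt (2 * t) • (x - y))) := by
      intro w
      rw [RCLike.re_eq_complex_re, Complex.exp_ofReal_mul_I_re]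
    simp only [e] at h2
    rw [h2]
    have e2 : ‖Real.sqrt (2 * t) • (x - y)‖ ^ 2 = 2 * t * ‖x - y‖ ^ 2 := by
      rw [norm_smul, mul_pow, Real.norm_eq_abs, sq_abs, Real.sq_sqrt (by positivity)]
    have e3 : -((‖Real.sqrt (2 * t) • (x - y)‖ : ℂ) ^ 2) / 2 =
        ((-((t : ℝ) * ‖x - y‖ ^ 2) : ℝ) : ℂ) := by
      rw [← Complex.ofReal_pow, e2]; push_cast; ring
    rw [e3, ← Complex.ofReal_exp, RCLike.re_eq_complex_re, Complex.ofReal_re]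
  · refine Integrable.of_bound (by fun_prop) 1 (ae_of_all _ fun w => ?_)
    rw [Complex.norm_exp_ofReal_mul_I]

theorem radialKernel_sum_nonneg {d : ℕ} (ν : Measure ℝ≥0) [IsFiniteMeasure ν]
    (s : Finset (EuclideanSpace ℝ (Fin d))) (c : EuclideanSpace ℝ (Fin d) → ℝ) :
    0 ≤ ∑ x ∈ s, ∑ y ∈ s, c x * c y * radialKernel ν x y := by
  have h1 : ∀ t : ℝ≥0,
      0 ≤ ∑ x ∈ s, ∑ y ∈ s, c x * c y * Real.exp (-((t : ℝ) * ‖x - y‖ ^ 2)) := by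
    intro t
    simp only [exp_neg_eq_integral_cos, ← integral_const_mul]
    have hi : ∀ x y : EuclideanSpace ℝ (Fin d), Integrable (fun w => c x * c y *
        Real.cos (inner ℝ w (Real.sqrt (2 * t) • (x - y))))
        (ProbabilityTheory.stdGaussian (EuclideanSpace ℝ (Fin d))) := by
      intro x y
      refine (Integrable.of_bound (by fun_prop) 1 (ae_of_all _ fun w => ?_)).const_mul _
      exact Real.abs_cos_le_one _
    have e : ∀ x ∈ s, ∑ y ∈ s, ∫ w, c x * c y *
        Real.cos (inner ℝ w (Real.sqrt (2 * t) • (x - y)))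
          ∂(ProbabilityTheory.stdGaussian (EuclideanSpace ℝ (Fin d))) =
        ∫ w, ∑ y ∈ s, c x * c y * Real.cos (inner ℝ w (Real.sqrt (2 * t) • (x - y)))
          ∂(ProbabilityTheory.stdGaussian (EuclideanSpace ℝ (Fin d))) := fun x _ =>
      (integral_finsetSum s fun y _ => hi x y).symm
    rw [Finset.sum_congr rfl e,
      ← integral_finsetSum s fun x _ => integrable_finsetSum s fun y _ => hi x y]
    refine integral_nonneg fun w => ?_
    have key : ∑ x ∈ s, ∑ y ∈ s, c x * c y *
          Real.cos (inner ℝ w (Real.sqrt (2 * t) • (x - y))) =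
        (∑ x ∈ s, c x * Real.cos (inner ℝ w (Real.sqrt (2 * t) • x))) ^ 2 +
        (∑ x ∈ s, c x * Real.sin (inner ℝ w (Real.sqrt (2 * t) • x))) ^ 2 := by
      rw [sq, sq, Finset.sum_mul_sum, Finset.sum_mul_sum, ← Finset.sum_add_distrib]
      refine Finset.sum_congr rfl fun x _ => ?_
      rw [← Finset.sum_add_distrib]
      refine Finset.sum_congr rfl fun y _ => ?_
      rw [smul_sub, inner_sub_right, Real.cos_sub]
      ring
    show 0 ≤ ∑ x ∈ s, ∑ y ∈ s, c x * c y *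
          Real.cos (inner ℝ w (Real.sqrt (2 * t) • (x - y)))
    rw [key]
    positivity
  have h2 : ∑ x ∈ s, ∑ y ∈ s, c x * c y * radialKernel ν x y =
      ∫ t : ℝ≥0, ∑ x ∈ s, ∑ y ∈ s, c x * c y * Real.exp (-((t : ℝ) * ‖x - y‖ ^ 2)) ∂ν := by
    rw [integral_finsetSum s fun x _ => integrable_finsetSum s fun y _ =>
      (integrable_radialKernel ν x y).const_mul _]
    refine Finset.sum_congr rfl fun x _ => ?_
    rw [integral_finsetSum s fun y _ => (integrable_radialKernel ν x y).const_mul _]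
    refine Finset.sum_congr rfl fun y _ => ?_
    rw [integral_const_mul, radialKernel]
  rw [h2]
  exact integral_nonneg h1

/-- The radial kernel as an operator-valued matrix, the form used by `RKHS.kernel`. -/
def radialMatrix {d : ℕ} (ν : Measure ℝ≥0) :
    Matrix (EuclideanSpace ℝ (Fin d)) (EuclideanSpace ℝ (Fin d)) (ℝ →L[ℝ] ℝ) :=
  Matrix.of fun x y => radialKernel ν x y • (1 : ℝ →L[ℝ] ℝ)

open scoped ComplexOrder in
theorem radialMatrix_posSemidef {d : ℕ} (ν : Measure ℝ≥0) [IsFiniteMeasure ν] :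
    (radialMatrix (d := d) ν).PosSemidef := by
  have tfae := RKHS.posSemidef_tfae (K := radialMatrix (d := d) ν)
  have iff := tfae.out 0 2
  refine iff.mpr ⟨?_, fun vv => ?_⟩
  · ext x y
    simp [radialMatrix, radialKernel, norm_sub_rev x y]
  · have h := radialKernel_sum_nonneg ν vv.support (fun x => vv x)
    refine h.trans_eq ?_
    simp only [Finsupp.sum, radialMatrix, Matrix.of_apply, RCLike.re_to_real]
    refine Finset.sum_congr rfl fun x _ => Finset.sum_congr rfl fun y _ => ?_
    simp [radialKernel, norm_sub_rev x y]
    ring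

instance fact_radialMatrix_posSemidef {d : ℕ} (ν : Measure ℝ≥0) [IsFiniteMeasure ν] :
    Fact (radialMatrix (d := d) ν).PosSemidef := ⟨radialMatrix_posSemidef ν⟩

/-- An explicit model of the reproducing kernel Hilbert space `H_k` of the radial kernel `k` on
`ℝᵈ`. Any Hilbert space of functions with reproducing kernel `k` is isometric to it, pointwise as
functions. -/
abbrev RadialRKHS (d : ℕ) (ν : Measure ℝ≥0) [IsFiniteMeasure ν] : Type :=
  RKHS.OfKernel (radialMatrix (d := d) ν)

theorem kernel_radialRKHS {d : ℕ} (ν : Measure ℝ≥0) [IsFiniteMeasure ν]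
    (x y : EuclideanSpace ℝ (Fin d)) :
    RKHS.kernel (RadialRKHS d ν) x y 1 = radialKernel ν x y := by
  rw [RKHS.OfKernel.kernel_ofKernel]
  simp [radialMatrix]

theorem continuous_radialKernel_sub {d : ℕ} (ν : Measure ℝ≥0) [IsFiniteMeasure ν]
    (x : EuclideanSpace ℝ (Fin d)) : Continuous fun y => radialKernel ν x y := by
  refine continuous_of_dominated (bound := fun _ => 1) (fun y => by fun_prop)
    (fun y => ae_of_all _ fun t => ?_) (integrable_const _) (ae_of_all _ fun t => by fun_prop)
  rw [Real.norm_eq_abs, abs_of_pos (Real.exp_pos _), Real.exp_le_one_iff]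
  have := t.2
  have : 0 ≤ (t : ℝ) * ‖x - y‖ ^ 2 := by positivity
  linarith

/-- The Bochner integral that defines the kernel mean embedding converges for radial kernels. -/
theorem integrable_featureMap {d : ℕ} (ν : Measure ℝ≥0) [IsFiniteMeasure ν]
    {H : Type*} [NormedAddCommGroup H] [InnerProductSpace ℝ H] [CompleteSpace H]
    [RKHS ℝ H (EuclideanSpace ℝ (Fin d)) ℝ]
    (hk : ∀ x y : EuclideanSpace ℝ (Fin d), RKHS.kernel H x y 1 = radialKernel ν x y)
    (P : Measure (EuclideanSpace ℝ (Fin d))) [IsFiniteMeasure P] :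
    Integrable (featureMap H) P := by
  have inn : ∀ x y : EuclideanSpace ℝ (Fin d),
      inner ℝ (featureMap H y) (featureMap H x) = radialKernel ν x y := by
    intro x y
    have := RKHS.kernel_inner H x y (1 : ℝ) 1
    rw [hk] at this
    simpa [featureMap] using this.symm
  have diag : ∀ x : EuclideanSpace ℝ (Fin d), radialKernel ν x x = ν.real Set.univ := by
    intro x; simp [radialKernel]
  have symm : ∀ x y : EuclideanSpace ℝ (Fin d), radialKernel ν x y = radialKernel ν y x := by
    intro x y; simp [radialKernel, norm_sub_rev x y]
  have nrm : ∀ x : EuclideanSpace ℝ (Fin d), ‖featureMap H x‖ ^ 2 = ν.real Set.univ := by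
    intro x; rw [← real_inner_self_eq_norm_sq, inn, diag]
  have cont : Continuous (featureMap H : EuclideanSpace ℝ (Fin d) → H) := by
    rw [continuous_iff_continuousAt]
    intro x
    have e : ∀ y, ‖featureMap H y - featureMap H x‖ =
        √(2 * ν.real Set.univ - 2 * radialKernel ν x y) := by
      intro y
      rw [← Real.sqrt_sq (norm_nonneg (featureMap H y - featureMap H x)), norm_sub_sq_real,
        nrm, nrm, inn]
      congr 1
      ring
    rw [ContinuousAt, tendsto_iff_norm_sub_tendsto_zero]
    simp only [e]
    have hc : Continuous fun y => √(2 * ν.real Set.univ - 2 * radialKernel ν x y) := by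
      have := continuous_radialKernel_sub ν x
      fun_prop
    have := hc.tendsto x
    simpa [diag] using this
  refine Integrable.of_bound cont.aestronglyMeasurable (√(ν.real Set.univ)) (ae_of_all _ fun x => ?_)
  rw [← nrm x, Real.sqrt_sq (norm_nonneg _)]

end

/-! Le Cam's two-point method. Take a smooth law `Q` in a ball of radius `r` of order `1/√t₁` and
its translate `Q'` by a vector of length `1/√t₀ + 1/√t₁`. Compare the mixtures of `Q` and `Q'` with
weights `1/2, 1/2` and `(1 + a)/2, (1 - a)/2`, where `a = 1/(2√n)`.

Since `Q` and `Q'` live on disjoint sets, the `χ²`-divergence of the mixtures is `a² = 1/(4n)`, and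
`n` observations cannot tell them apart reliably (`pi_binaryMixture_le_add`).

The embeddings of the mixtures differ by `a/2` times `μ(Q) - μ(Q')`. For `t` in `[t₀, t₁]` the
Gaussian `exp(-t‖x - y‖²)` is at least `3/4` inside each ball and at most `1/2` between the two, and
every other `t` contributes a nonnegative amount, so `‖μ(Q) - μ(Q')‖² ≥ β/2`
(`le_norm_kernelMeanEmbedding_sub_map_sq`). The squared separation is thus at least `β/(32n)`, while
twice the claimed radius has square at most `β/(1250n)`. -/

/-! ### Product laws, `χ²`-divergence and two-point testing -/

/-- The product of measures with densities has the product density. -/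
theorem pi_withDensity_ofReal {X ι : Type*} [MeasurableSpace X] [Fintype ι] (P : Measure X)
    [IsProbabilityMeasure P] {h : X → ℝ} (h0 : ∀ x, 0 ≤ h x)
    (hi : Integrable h P) :
    (Measure.pi fun _ : ι => P.withDensity fun x => ENNReal.ofReal (h x)) =
      (Measure.pi fun _ : ι => P).withDensity fun x => ENNReal.ofReal (∏ i, h (x i)) := by
  have := isFiniteMeasure_withDensity_ofReal hi.2
  refine Measure.pi_eq fun s hs => ?_
  -- On a box the truncated product density is again a product of one-variable functions, so its
  -- integral factorises.
  have e : (Set.univ.pi s).indicator (fun x : ι → X => ENNReal.ofReal (∏ i, h (x i))) =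
      fun x => ENNReal.ofReal (∏ i, (s i).indicator h (x i)) := by
    classical
    ext x
    by_cases hx : x ∈ Set.univ.pi s
    · rw [Set.indicator_of_mem hx]
      congr 1
      exact Finset.prod_congr rfl fun i _ => (Set.indicator_of_mem (hx i trivial) h).symm
    · rw [Set.indicator_of_notMem hx]
      simp only [Set.mem_pi, Set.mem_univ, true_imp_iff, not_forall] at hx
      obtain ⟨i, hxi⟩ := hx
      rw [Finset.prod_eq_zero (Finset.mem_univ i) (Set.indicator_of_notMem hxi h),
        ENNReal.ofReal_zero]
  have his : ∀ i, Integrable ((s i).indicator h) P := fun i => hi.indicator (hs i)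
  have h0s : ∀ i x, 0 ≤ (s i).indicator h x := fun i => Set.indicator_nonneg fun x _ => h0 x
  rw [withDensity_apply _ (MeasurableSet.univ_pi hs), ← lintegral_indicator
    (MeasurableSet.univ_pi hs), e, ← ofReal_integral_eq_lintegral_ofReal
    (Integrable.fintype_prod_dep his) (ae_of_all _ fun x => Finset.prod_nonneg fun i _ => h0s i _),
    integral_fintype_prod_eq_prod (μ := fun _ => P) (fun i => (s i).indicator h),
    ENNReal.ofReal_prod_of_nonneg fun i _ => integral_nonneg (h0s i)]
  refine Finset.prod_congr rfl fun i _ => ?_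
  rw [withDensity_apply _ (hs i), integral_indicator (hs i),
    ofReal_integral_eq_lintegral_ofReal hi.restrict (ae_of_all _ h0)]

/-- If the `χ²`-divergence of `P.withDensity h` from `P` is at most `1 / (4 n)`, then the `n`-fold
products assign to every event probabilities that differ by at most `3 / 5`. -/
theorem pi_le_pi_withDensity_add {X : Type*} [MeasurableSpace X] (P : Measure X)
    [IsProbabilityMeasure P] {h : X → ℝ} {C : ℝ} (hm : Measurable h) (h0 : ∀ x, 0 ≤ h x)
    (hC : ∀ x, h x ≤ C) (h1 : ∫ x, h x ∂P = 1) {n : ℕ} (hn : 0 < n)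
    (h2 : ∫ x, h x ^ 2 ∂P ≤ 1 + 1 / (4 * n)) {A : Set (Fin n → X)} (hA : MeasurableSet A) :
    (Measure.pi fun _ : Fin n => P) A ≤
      (Measure.pi fun _ : Fin n => P.withDensity fun x => ENNReal.ofReal (h x)) A + 3 / 5 := by
  have hi : Integrable h P := Integrable.of_bound hm.aestronglyMeasurable C
    (ae_of_all _ fun x => by rw [Real.norm_of_nonneg (h0 x)]; exact hC x)
  have hi2 : Integrable (fun x => h x ^ 2) P :=
    Integrable.of_bound (by fun_prop) (C ^ 2) (ae_of_all _ fun x => by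
      rw [Real.norm_of_nonneg (sq_nonneg _)]; exact pow_le_pow_left₀ (h0 x) (hC x) 2)
  rw [pi_withDensity_ofReal P h0 hi]
  set μ := Measure.pi fun _ : Fin n => P
  set L : (Fin n → X) → ℝ := fun x => ∏ i, h (x i)
  have L0 : ∀ x, 0 ≤ L x := fun x => Finset.prod_nonneg fun i _ => h0 _
  have Li : Integrable L μ := Integrable.fintype_prod_dep fun _ => hi
  have L2e : (fun x => L x ^ 2) = fun x => ∏ i, h (x i) ^ 2 := by
    ext x; exact (Finset.prod_pow _ _ _).symm
  have Li2 : Integrable (fun x => L x ^ 2) μ := by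
    rw [L2e]; exact Integrable.fintype_prod_dep (f := fun _ x => h x ^ 2) fun _ => hi2
  have L1 : ∫ x, L x ∂μ = 1 := by
    rw [integral_fintype_prod_eq_prod (μ := fun _ => P) (fun _ => h)]
    simp [h1]
  -- The second moment of the likelihood ratio tensorises: `(1 + 1/(4n))ⁿ ≤ e^(1/4) ≤ 4/3`, the last
  -- because `e^(-1/4) ≥ 3/4`.
  have L2 : ∫ x, L x ^ 2 ∂μ ≤ 4 / 3 := by
    rw [L2e, integral_fintype_prod_eq_prod (μ := fun _ => P) (fun _ x => h x ^ 2),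
      Finset.prod_const, Finset.card_univ, Fintype.card_fin]
    have n0 : (0 : ℝ) < n := by exact_mod_cast hn
    have a : (∫ x, h x ^ 2 ∂P) ≤ Real.exp (1 / (4 * n)) :=
      h2.trans (by linarith [Real.add_one_le_exp (1 / (4 * (n : ℝ)))])
    have b := pow_le_pow_left₀ (integral_nonneg fun x => sq_nonneg (h x)) a n
    rw [← Real.exp_nat_mul] at b
    have c : (n : ℝ) * (1 / (4 * n)) = 1 / 4 := by field_simp
    rw [c] at b
    have e := Real.one_sub_le_exp_neg (1 / 4 : ℝ)
    rw [Real.exp_neg, le_inv_comm₀ (by norm_num) (Real.exp_pos _)] at e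
    refine b.trans (e.trans (by norm_num))
  have D2i : Integrable (fun x => (L x ^ 2 - 2 * L x) + 1) μ :=
    (Li2.sub (Li.const_mul 2)).add (integrable_const _)
  have D2 : ∫ x, (L x ^ 2 - 2 * L x) + 1 ∂μ ≤ 1 / 3 := by
    rw [integral_add (f := fun x => L x ^ 2 - 2 * L x) (Li2.sub (Li.const_mul 2)) (integrable_const _),
      integral_sub Li2 (Li.const_mul 2), integral_const_mul, L1]
    simp
    linarith
  -- Pointwise `1 - L ≤ 1/4 + (1 - L)²`. The right side is nonnegative, so its integral over `A` is
  -- at most the one over the whole space, `1/4 + 1/3 = 7/12 ≤ 3/5`.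
  have key : μ.real A - ∫ x in A, L x ∂μ ≤ 3 / 5 := by
    have e1 : μ.real A = ∫ x in A, (1 : ℝ) ∂μ := by simp
    rw [e1, ← integral_sub (integrable_const _) Li.restrict]
    calc ∫ x in A, (1 - L x) ∂μ
        ≤ ∫ x in A, (1 / 4 + ((L x ^ 2 - 2 * L x) + 1)) ∂μ := by
          refine integral_mono ((integrable_const _).sub Li.restrict)
            ((integrable_const _).add D2i.restrict) fun x => ?_
          dsimp only
          nlinarith [sq_nonneg (1 - L x - 1 / 2)]
      _ ≤ ∫ x, (1 / 4 + ((L x ^ 2 - 2 * L x) + 1)) ∂μ := by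
          refine setIntegral_le_integral ((integrable_const _).add D2i) (ae_of_all _ fun x => ?_)
          have := sq_nonneg (L x - 1)
          show 0 ≤ 1 / 4 + ((L x ^ 2 - 2 * L x) + 1)
          linarith
      _ ≤ 3 / 5 := by
          rw [integral_add (integrable_const _) D2i]
          simp only [integral_const, probReal_univ, smul_eq_mul]
          linarith
  rw [withDensity_apply _ hA, ← ofReal_integral_eq_lintegral_ofReal Li.restrict (ae_of_all _ L0),
    ← ENNReal.ofReal_toReal (measure_ne_top μ A)]
  have c : (3 / 5 : ℝ≥0∞) = ENNReal.ofReal (3 / 5) := by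
    rw [ENNReal.ofReal_div_of_pos (by norm_num)]; norm_num
  rw [c, ← ENNReal.ofReal_add (integral_nonneg L0) (by norm_num)]
  refine ENNReal.ofReal_le_ofReal ?_
  change μ.real A ≤ _
  linarith

/-- **Le Cam's two-point method.** -/
theorem one_fifth_le_minimaxProbability {X H : Type*} [MeasurableSpace X] [NormedAddCommGroup H]
    [MeasurableSpace H] [BorelSpace H] {C : Set (Measure X)} {θ : Measure X → H} {n : ℕ} {s : ℝ}
    {P Q : Measure X} [IsProbabilityMeasure P] [IsProbabilityMeasure Q] (hP : P ∈ C) (hQ : Q ∈ C)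
    (hs : 2 * s ≤ ‖θ P - θ Q‖)
    (h : ∀ A : Set (Fin n → X), MeasurableSet A →
      (Measure.pi fun _ : Fin n => P) A ≤ (Measure.pi fun _ : Fin n => Q) A + 3 / 5) :
    1 / 5 ≤ minimaxProbability C θ n s := by
  refine le_iInf fun ⟨f, hf⟩ => ?_
  set S := ⨆ P ∈ C, (Measure.pi fun _ : Fin n => P) {x | s ≤ ‖f x - θ P‖}
  set A := {x | s ≤ ‖f x - θ P‖}
  set B := {x | s ≤ ‖f x - θ Q‖}
  have hA : MeasurableSet A :=
    measurableSet_le measurable_const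
      ((by fun_prop : Continuous fun y : H => ‖y - θ P‖).measurable.comp hf)
  have hAS : (Measure.pi fun _ : Fin n => P) A ≤ S :=
    le_iSup₂ (f := fun P (_ : P ∈ C) =>
      (Measure.pi fun _ : Fin n => P) {x | s ≤ ‖f x - θ P‖}) P hP
  have hBS : (Measure.pi fun _ : Fin n => Q) B ≤ S :=
    le_iSup₂ (f := fun P (_ : P ∈ C) =>
      (Measure.pi fun _ : Fin n => P) {x | s ≤ ‖f x - θ P‖}) Q hQ
  have sub : Aᶜ ⊆ B := by
    intro x hx
    simp only [A, B, Set.mem_compl_iff, Set.mem_ofPred_eq, not_le] at hx ⊢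
    have := norm_sub_le_norm_sub_add_norm_sub (θ P) (f x) (θ Q)
    rw [norm_sub_rev (θ P) (f x)] at this
    linarith
  -- An estimate close to `θ P` is far from `θ Q`, so the two error probabilities sum to at least `1
  -- - 3/5`, and the worse one is at least `1/5`.
  have e : (1 : ℝ≥0∞) ≤ S + (S + 3 / 5) := by
    rw [← prob_add_prob_compl (μ := Measure.pi fun _ : Fin n => P) hA]
    refine add_le_add hAS ((h _ hA.compl).trans ?_)
    gcongr
    exact (measure_mono sub).trans hBS
  by_contra! hlt
  have hS : S ≠ ⊤ := ne_top_of_lt hlt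
  rw [← ENNReal.ofReal_toReal hS] at e hlt
  have c : (3 / 5 : ℝ≥0∞) = ENNReal.ofReal (3 / 5) := by
    rw [ENNReal.ofReal_div_of_pos (by norm_num)]; norm_num
  have c' : (1 / 5 : ℝ≥0∞) = ENNReal.ofReal (1 / 5) := by
    rw [ENNReal.ofReal_div_of_pos (by norm_num)]; norm_num
  rw [c, ← ENNReal.ofReal_add (by positivity) (by norm_num),
    ← ENNReal.ofReal_add (by positivity) (by positivity), ENNReal.one_le_ofReal] at e
  rw [c', ENNReal.ofReal_lt_ofReal_iff (by norm_num)] at hlt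
  linarith

/-- The squared norm of a mean is at least any lower bound of the pairwise inner products. -/
theorem le_norm_integral_sq {X H : Type*} [MeasurableSpace X] [NormedAddCommGroup H]
    [InnerProductSpace ℝ H] [CompleteSpace H] {Q : Measure X} [IsProbabilityMeasure Q] {ψ : X → H}
    (hψ : Integrable ψ Q) {S : Set X} (hS : ∀ᵐ x ∂Q, x ∈ S) {c : ℝ}
    (hc : ∀ x ∈ S, ∀ y ∈ S, c ≤ inner ℝ (ψ x) (ψ y)) :
    c ≤ ‖∫ x, ψ x ∂Q‖ ^ 2 := by
  -- Averaging in one argument of the inner product; applied twice, once per argument.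
  have mean : ∀ w : H, (∀ x ∈ S, c ≤ inner ℝ w (ψ x)) → c ≤ inner ℝ w (∫ x, ψ x ∂Q) := by
    intro w hw
    rw [← integral_inner hψ w]
    calc c = ∫ _, c ∂Q := by simp
      _ ≤ _ := integral_mono_ae (integrable_const _) (hψ.const_inner w)
        (hS.mono fun x hx => hw x hx)
  rw [← real_inner_self_eq_norm_sq]
  refine mean _ fun x hx => ?_
  rw [real_inner_comm]
  exact mean _ fun y hy => hc x hx y hy

/-! ### Mixtures of two separated laws -/

/-- The mixture `(1 + a) / 2 · Q₀ + (1 - a) / 2 · Q₁`. -/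
noncomputable def binaryMixture {X : Type*} [MeasurableSpace X] (Q₀ Q₁ : Measure X) (a : ℝ) :
    Measure X :=
  ENNReal.ofReal ((1 + a) / 2) • Q₀ + ENNReal.ofReal ((1 - a) / 2) • Q₁

section Mixture

variable {X : Type*} [MeasurableSpace X] {Q₀ Q₁ : Measure X} {a : ℝ}

theorem isProbabilityMeasure_binaryMixture [IsProbabilityMeasure Q₀] [IsProbabilityMeasure Q₁]
    (h0 : 0 ≤ a) (h1 : a ≤ 1) : IsProbabilityMeasure (binaryMixture Q₀ Q₁ a) := by
  constructor
  simp only [binaryMixture, Measure.add_apply, Measure.smul_apply, measure_univ, smul_eq_mul,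
    mul_one]
  rw [← ENNReal.ofReal_add (by linarith) (by linarith), ← ENNReal.ofReal_one]
  congr 1
  ring

theorem integral_binaryMixture {H : Type*} [NormedAddCommGroup H] [NormedSpace ℝ H] {F : X → H}
    (hF₀ : Integrable F Q₀) (hF₁ : Integrable F Q₁) (h0 : 0 ≤ a) (h1 : a ≤ 1) :
    ∫ x, F x ∂(binaryMixture Q₀ Q₁ a) =
      ((1 + a) / 2) • ∫ x, F x ∂Q₀ + ((1 - a) / 2) • ∫ x, F x ∂Q₁ := by
  rw [binaryMixture, integral_add_measure (hF₀.smul_measure ENNReal.ofReal_ne_top)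
    (hF₁.smul_measure ENNReal.ofReal_ne_top), integral_smul_measure, integral_smul_measure,
    ENNReal.toReal_ofReal (by linarith), ENNReal.toReal_ofReal (by linarith)]

/-- Products of mixtures of separated laws with nearby weights are hard to distinguish. -/
theorem pi_binaryMixture_le_add [IsProbabilityMeasure Q₀] [IsProbabilityMeasure Q₁]
    {S : Set X} (hS : MeasurableSet S) (hS₀ : ∀ᵐ x ∂Q₀, x ∈ S) (hS₁ : ∀ᵐ x ∂Q₁, x ∉ S)
    (h0 : 0 ≤ a) (h1 : a ≤ 1) {n : ℕ} (hn : 0 < n) (ha : a ^ 2 ≤ 1 / (4 * n))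
    {A : Set (Fin n → X)} (hA : MeasurableSet A) :
    (Measure.pi fun _ : Fin n => binaryMixture Q₀ Q₁ 0) A ≤
      (Measure.pi fun _ : Fin n => binaryMixture Q₀ Q₁ a) A + 3 / 5 := by
  classical
  have := isProbabilityMeasure_binaryMixture (Q₀ := Q₀) (Q₁ := Q₁) le_rfl zero_le_one
  -- The density of the tilted mixture with respect to the balanced one: `S` carries `Q₀` and its
  -- complement carries `Q₁`.
  set h : X → ℝ := S.piecewise (fun _ => 1 + a) (fun _ => 1 - a)
  have hm : Measurable h := Measurable.piecewise hS measurable_const measurable_const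
  have hS' : ∀ x ∈ S, h x = 1 + a := fun x hx => Set.piecewise_eq_of_mem _ _ _ hx
  have hS'' : ∀ x ∉ S, h x = 1 - a := fun x hx => Set.piecewise_eq_of_notMem _ _ _ hx
  have hpos : ∀ x, 0 ≤ h x := fun x => by
    by_cases hx : x ∈ S
    · rw [hS' x hx]; linarith
    · rw [hS'' x hx]; linarith
  have hle : ∀ x, h x ≤ 2 := fun x => by
    by_cases hx : x ∈ S
    · rw [hS' x hx]; linarith
    · rw [hS'' x hx]; linarith
  have e₀ : h =ᵐ[Q₀] fun _ => 1 + a := hS₀.mono hS'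
  have e₁ : h =ᵐ[Q₁] fun _ => 1 - a := hS₁.mono hS''
  have dens : (binaryMixture Q₀ Q₁ 0).withDensity (fun x => ENNReal.ofReal (h x)) =
      binaryMixture Q₀ Q₁ a := by
    have f₀ : (fun x => ENNReal.ofReal (h x)) =ᵐ[Q₀] fun _ => ENNReal.ofReal (1 + a) :=
      e₀.fun_comp ENNReal.ofReal
    have f₁ : (fun x => ENNReal.ofReal (h x)) =ᵐ[Q₁] fun _ => ENNReal.ofReal (1 - a) :=
      e₁.fun_comp ENNReal.ofReal
    rw [binaryMixture, withDensity_add_measure, withDensity_smul_measure, withDensity_smul_measure,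
      withDensity_congr_ae f₀,
      withDensity_congr_ae f₁]
    simp only [withDensity_const, binaryMixture, smul_smul]
    rw [← ENNReal.ofReal_mul (by norm_num), ← ENNReal.ofReal_mul (by norm_num)]
    congr 3 <;> ring
  have int : ∀ F : ℝ → ℝ, ∫ x, F (h x) ∂(binaryMixture Q₀ Q₁ 0) =
      1 / 2 * F (1 + a) + 1 / 2 * F (1 - a) := by
    intro F
    have f₀ : (fun x => F (h x)) =ᵐ[Q₀] fun _ => F (1 + a) := e₀.fun_comp F
    have f₁ : (fun x => F (h x)) =ᵐ[Q₁] fun _ => F (1 - a) := e₁.fun_comp F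
    rw [integral_binaryMixture ((integrable_congr f₀).2 (integrable_const _))
      ((integrable_congr f₁).2 (integrable_const _)) le_rfl zero_le_one,
      integral_congr_ae f₀, integral_congr_ae f₁]
    simp
  rw [← dens]
  refine pi_le_pi_withDensity_add _ hm hpos hle ?_ hn ?_ hA
  · rw [int fun y => y]; ring
  -- The second moment of `h` is `1 + a²`.
  · rw [int fun y => y ^ 2]; linarith

end Mixture

/-! ### Laws with smooth density -/

theorem binaryMixture_mem_smoothDensityLaws {d : ℕ} {Q₀ Q₁ : Measure (EuclideanSpace ℝ (Fin d))}
    (h₀ : Q₀ ∈ smoothDensityLaws d) (h₁ : Q₁ ∈ smoothDensityLaws d) {a : ℝ} (ha0 : 0 ≤ a)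
    (ha1 : a ≤ 1) : binaryMixture Q₀ Q₁ a ∈ smoothDensityLaws d := by
  obtain ⟨hp, q₀, c₀, n₀, e₀⟩ := h₀
  obtain ⟨hp', q₁, c₁, n₁, e₁⟩ := h₁
  have m₀ : Measurable q₀ := c₀.continuous.measurable
  have m₁ : Measurable q₁ := c₁.continuous.measurable
  have b₀ : 0 ≤ (1 + a) / 2 := by linarith
  have b₁ : 0 ≤ (1 - a) / 2 := by linarith
  refine ⟨isProbabilityMeasure_binaryMixture ha0 ha1,
    fun x => (1 + a) / 2 * q₀ x + (1 - a) / 2 * q₁ x,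
    (contDiff_const.mul c₀).add (contDiff_const.mul c₁),
    fun x => add_nonneg (mul_nonneg b₀ (n₀ x)) (mul_nonneg b₁ (n₁ x)), ?_⟩
  rw [binaryMixture, e₀, e₁, ← withDensity_smul _ (by fun_prop), ← withDensity_smul _ (by fun_prop),
    ← withDensity_add_left (by fun_prop)]
  congr 1
  ext x
  simp only [Pi.add_apply, Pi.smul_apply, smul_eq_mul]
  rw [ENNReal.ofReal_add (mul_nonneg b₀ (n₀ x)) (mul_nonneg b₁ (n₁ x)), ENNReal.ofReal_mul b₀,
    ENNReal.ofReal_mul b₁]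

theorem map_add_right_mem_smoothDensityLaws {d : ℕ} {Q : Measure (EuclideanSpace ℝ (Fin d))}
    (h : Q ∈ smoothDensityLaws d) (m : EuclideanSpace ℝ (Fin d)) :
    Q.map (· + m) ∈ smoothDensityLaws d := by
  obtain ⟨hp, q, c, n, e⟩ := h
  have hm : Measurable fun x : EuclideanSpace ℝ (Fin d) => x + m := measurable_add_const m
  refine ⟨Measure.isProbabilityMeasure_map hm.aemeasurable, fun x => q (x - m),
    c.comp (contDiff_id.sub contDiff_const), fun x => n _, ?_⟩
  ext s hs
  rw [Measure.map_apply hm hs, e, withDensity_apply _ (hm hs), withDensity_apply _ hs,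
    ← lintegral_indicator (hm hs), ← lintegral_indicator hs,
    ← lintegral_add_right_eq_self (s.indicator fun x => ENNReal.ofReal (q (x - m))) m]
  refine lintegral_congr fun x => ?_
  simp only [Set.indicator, add_sub_cancel_right]
  rfl

/-- There are laws with smooth density concentrated in arbitrarily small balls. -/
theorem exists_smoothDensityLaws_ball (d : ℕ) {r : ℝ} (hr : 0 < r) :
    ∃ Q ∈ smoothDensityLaws d, ∀ᵐ x ∂Q, x ∈ Metric.ball (0 : EuclideanSpace ℝ (Fin d)) r := by
  let f : ContDiffBump (0 : EuclideanSpace ℝ (Fin d)) := ⟨r / 2, r, by positivity, by linarith⟩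
  have hc : Continuous (f.normed volume) := f.continuous_normed
  refine ⟨volume.withDensity fun x => ENNReal.ofReal (f.normed volume x),
    ⟨⟨?_⟩, f.normed volume, f.contDiff_normed, f.nonneg_normed, rfl⟩, ?_⟩
  · rw [withDensity_apply _ .univ, Measure.restrict_univ, ← ofReal_integral_eq_lintegral_ofReal
      f.integrable_normed (ae_of_all _ f.nonneg_normed), f.integral_normed, ENNReal.ofReal_one]
  · rw [ae_withDensity_iff (by fun_prop)]
    refine ae_of_all _ fun x hx => ?_
    have hx' : x ∈ Function.support (f.normed volume) := fun h0 => hx (by simp [h0])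
    rwa [f.support_normed_eq] at hx'

/-! ### Separation of mean embeddings -/

/-- The second difference of `exp (-t ‖x - y‖²)` along a shift `m` that is large compared with the
distance of the points is nonnegative, and bounded below when `t` is of moderate size. -/
theorem radialKernel_shift_lower_bound {d : ℕ} (ν : Measure ℝ≥0) [IsFiniteMeasure ν]
    {t₀ t₁ : ℝ≥0} {r M : ℝ} (hr : 0 < r) (hM : 4 * r ≤ M) (h₁ : 16 * r ^ 2 * t₁ ≤ 1)
    (h₀ : 1 ≤ t₀ * (M - 2 * r) ^ 2) {m x y : EuclideanSpace ℝ (Fin d)} (hm : ‖m‖ = M)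
    (hx : x ∈ Metric.ball 0 r) (hy : y ∈ Metric.ball 0 r) :
    ν.real (Set.Icc t₀ t₁) / 2 ≤ radialKernel ν x y - radialKernel ν x (y + m) -
      (radialKernel ν (x + m) y - radialKernel ν (x + m) (y + m)) := by
  rw [mem_ball_zero_iff] at hx hy
  have near : ‖x - y‖ ≤ 2 * r := (norm_sub_le x y).trans (by linarith)
  have far : ∀ z : EuclideanSpace ℝ (Fin d), ‖z‖ ≤ 2 * r → M - 2 * r ≤ ‖z - m‖ := by
    intro z hz
    have := norm_sub_norm_le m z
    rw [norm_sub_rev m z] at this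
    linarith
  have f1 : M - 2 * r ≤ ‖x - (y + m)‖ := by
    rw [← sub_sub]; exact far _ near
  have f2 : M - 2 * r ≤ ‖x + m - y‖ := by
    rw [show x + m - y = -((y - x) - m) by abel, norm_neg]
    exact far _ (by rwa [norm_sub_rev])
  have f3 : x + m - (y + m) = x - y := by abel
  have I := fun u v : EuclideanSpace ℝ (Fin d) => integrable_radialKernel ν u v
  -- The second difference has two near terms and two far terms, so for `t` in the window it is at
  -- least `2 · (3/4 - 1/2) = 1/2`.
  have half1 : (3 / 4 : ℝ) ≤ Real.exp (-(1 / 4)) := by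
    have := Real.one_sub_le_exp_neg (1 / 4); linarith
  have half2 : Real.exp (-1) ≤ 1 / 2 := by
    rw [Real.exp_neg, inv_le_comm₀ (Real.exp_pos _) (by norm_num)]
    have := Real.add_one_le_exp (1 : ℝ); norm_num; linarith
  have mono : ∀ (t : ℝ≥0) {a b : ℝ}, 0 ≤ a → a ≤ b →
      Real.exp (-((t : ℝ) * b ^ 2)) ≤ Real.exp (-((t : ℝ) * a ^ 2)) := by
    intro t a b ha hab
    gcongr
  have pw : ∀ t : ℝ≥0, (Set.Icc t₀ t₁).indicator (fun _ => (1 / 2 : ℝ)) t ≤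
      Real.exp (-((t : ℝ) * ‖x - y‖ ^ 2)) - Real.exp (-((t : ℝ) * ‖x - (y + m)‖ ^ 2)) -
      (Real.exp (-((t : ℝ) * ‖x + m - y‖ ^ 2)) -
        Real.exp (-((t : ℝ) * ‖x + m - (y + m)‖ ^ 2))) := by
    intro t
    rw [f3]
    have a1 := mono t (norm_nonneg (x - y)) near
    have a2 := mono t (by linarith) f1
    have a3 := mono t (by linarith) f2
    by_cases h : t ∈ Set.Icc t₀ t₁
    · rw [Set.indicator_of_mem h]
      have b1 : Real.exp (-(1 / 4)) ≤ Real.exp (-((t : ℝ) * (2 * r) ^ 2)) := by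
        refine Real.exp_le_exp.2 (neg_le_neg ?_)
        have : (t : ℝ) ≤ t₁ := h.2
        have := mul_le_mul_of_nonneg_right this (sq_nonneg (2 * r))
        nlinarith
      have b2 : Real.exp (-((t : ℝ) * (M - 2 * r) ^ 2)) ≤ Real.exp (-1) := by
        refine Real.exp_le_exp.2 (neg_le_neg (h₀.trans ?_))
        have : (t₀ : ℝ) ≤ t := h.1
        gcongr
      linarith
    · rw [Set.indicator_of_notMem h]
      -- Outside the window only the order of the distances matters: near pairs are within `2r`, far
      -- pairs at least `M - 2r ≥ 2r` apart.
      have a4 := mono t (by linarith : 0 ≤ 2 * r) (by linarith : 2 * r ≤ M - 2 * r)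
      linarith
  have J : ∀ u v u' v' : EuclideanSpace ℝ (Fin d), Integrable (fun t : ℝ≥0 =>
      Real.exp (-((t : ℝ) * ‖u - v‖ ^ 2)) - Real.exp (-((t : ℝ) * ‖u' - v'‖ ^ 2))) ν :=
    fun u v u' v' => (I u v).sub (I u' v')
  simp only [radialKernel]
  rw [← integral_sub (I _ _) (I _ _), ← integral_sub (I _ _) (I _ _),
    ← integral_sub (J _ _ _ _) (J _ _ _ _)]
  calc ν.real (Set.Icc t₀ t₁) / 2
      = ∫ t, (Set.Icc t₀ t₁).indicator (fun _ => (1 / 2 : ℝ)) t ∂ν := by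
        rw [integral_indicator measurableSet_Icc]
        simp [div_eq_mul_inv]
    _ ≤ _ := integral_mono ((integrable_const _).indicator measurableSet_Icc)
        ((J _ _ _ _).sub (J _ _ _ _)) pw

theorem inner_featureMap {d : ℕ} {ν : Measure ℝ≥0} {H : Type*} [NormedAddCommGroup H]
    [InnerProductSpace ℝ H] [CompleteSpace H] [RKHS ℝ H (EuclideanSpace ℝ (Fin d)) ℝ]
    (hk : ∀ x y : EuclideanSpace ℝ (Fin d), RKHS.kernel H x y 1 = radialKernel ν x y)
    (x y : EuclideanSpace ℝ (Fin d)) :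
    inner ℝ (featureMap H y) (featureMap H x) = radialKernel ν x y := by
  have := RKHS.kernel_inner H x y (1 : ℝ) 1
  rw [hk] at this
  simpa [featureMap] using this.symm

/-- The mean embeddings of a concentrated law and of a distant translate of it are far apart. -/
theorem le_norm_kernelMeanEmbedding_sub_map_sq {d : ℕ} {ν : Measure ℝ≥0} [IsFiniteMeasure ν]
    {H : Type*} [NormedAddCommGroup H] [InnerProductSpace ℝ H] [CompleteSpace H]
    [RKHS ℝ H (EuclideanSpace ℝ (Fin d)) ℝ]
    (hk : ∀ x y : EuclideanSpace ℝ (Fin d), RKHS.kernel H x y 1 = radialKernel ν x y)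
    {t₀ t₁ : ℝ≥0} {r M : ℝ} (hr : 0 < r) (hM : 4 * r ≤ M) (h₁ : 16 * r ^ 2 * t₁ ≤ 1)
    (h₀ : 1 ≤ t₀ * (M - 2 * r) ^ 2) {m : EuclideanSpace ℝ (Fin d)} (hm : ‖m‖ = M)
    {Q : Measure (EuclideanSpace ℝ (Fin d))} [IsProbabilityMeasure Q]
    (hQ : ∀ᵐ x ∂Q, x ∈ Metric.ball (0 : EuclideanSpace ℝ (Fin d)) r) :
    ν.real (Set.Icc t₀ t₁) / 2 ≤
      ‖kernelMeanEmbedding H Q - kernelMeanEmbedding H (Q.map (· + m))‖ ^ 2 := by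
  have hmm : Measurable fun x : EuclideanSpace ℝ (Fin d) => x + m := measurable_add_const m
  have := Measure.isProbabilityMeasure_map (μ := Q) hmm.aemeasurable
  have i₀ := integrable_featureMap ν hk Q
  have i₁ := integrable_featureMap ν hk (Q.map (· + m))
  have i₂ : Integrable (fun x => featureMap H (x + m)) Q := i₁.comp_measurable hmm
  rw [kernelMeanEmbedding, kernelMeanEmbedding, integral_map hmm.aemeasurable
    i₁.aestronglyMeasurable, ← integral_sub i₀ i₂]
  refine le_norm_integral_sq (ψ := fun x => featureMap H x - featureMap H (x + m)) (i₀.sub i₂) hQ fun x hx y hy => ?_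
  simp only [inner_sub_left, inner_sub_right, inner_featureMap hk]
  refine (radialKernel_shift_lower_bound ν hr hM h₁ h₀ hm hy hx).trans_eq ?_
  ring

/-! ### The minimax lower bound -/

theorem theoremE1 {d : ℕ} (ν : Measure ℝ≥0) [IsFiniteMeasure ν] (hν : ν.support ≠ {0})
    {H : Type*} [NormedAddCommGroup H] [InnerProductSpace ℝ H] [CompleteSpace H]
    [MeasurableSpace H] [BorelSpace H] [RKHS ℝ H (EuclideanSpace ℝ (Fin d)) ℝ]
    (hk : ∀ x y : EuclideanSpace ℝ (Fin d), RKHS.kernel H x y 1 = radialKernel ν x y)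
    (t₀ t₁ : ℝ≥0) (β : ℝ) (ht₀ : 0 < t₀) (ht : t₀ ≤ t₁) (hβ : 0 < β)
    (hνβ : β ≤ ν.real (Set.Icc t₀ t₁))
    (n : ℕ) (hn : 24 * (t₁ * ν.real Set.univ / (β * t₀)) ≤ (n : ℝ)) :
    1 / 5 ≤ minimaxProbability (smoothDensityLaws d) (kernelMeanEmbedding H) n
      (1 / 50 * √(1 / (2 * n) * (β * t₀ / (t₁ * Real.exp 1) * (1 - 2 / (2 + d))))) := by
  have ht₁ : 0 < t₁ := ht₀.trans_le ht
  have p₀ : (0 : ℝ) < t₀ := ht₀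
  have p₁ : (0 : ℝ) < t₁ := ht₁
  have n0 : 0 < n := by
    have : (0 : ℝ) < ν.real Set.univ :=
      (hβ.trans_le hνβ).trans_le (measureReal_mono (Set.subset_univ _))
    have : (0 : ℝ) < n := lt_of_lt_of_le (by positivity) hn
    exact_mod_cast this
  have n0' : (0 : ℝ) < n := by exact_mod_cast n0
  -- For `d = 0` there is no nonzero translation, but `1 - 2/(2 + d)` vanishes, so the radius is
  -- zero and one law compared with itself suffices.
  rcases Nat.eq_zero_or_pos d with rfl | hd
  · obtain ⟨Q, hQ, -⟩ := exists_smoothDensityLaws_ball 0 one_pos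
    have := hQ.1
    refine one_fifth_le_minimaxProbability hQ hQ ?_ fun A _ => le_self_add
    simp
  -- This `r` gives `16 r² t₁ = 1`. The length `M` exceeds `4r` and leaves `M - 2r ≥ 1/√t₀`.
  set r : ℝ := 1 / (4 * √t₁)
  set M : ℝ := 4 * r + 1 / √t₀
  have hr : 0 < r := by positivity
  have hM : 4 * r ≤ M := by simp only [M]; linarith [show 0 < 1 / √(t₀ : ℝ) by positivity]
  have h₁ : 16 * r ^ 2 * t₁ ≤ 1 := by
    simp only [r, div_pow, mul_pow, Real.sq_sqrt p₁.le]
    field_simp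
    norm_num
  have h₀ : 1 ≤ t₀ * (M - 2 * r) ^ 2 := by
    have e : t₀ * (1 / √(t₀ : ℝ)) ^ 2 = 1 := by
      rw [div_pow, Real.sq_sqrt p₀.le]; field_simp
    rw [← e]
    gcongr
    simp only [M]; linarith
  have : Nonempty (Fin d) := ⟨⟨0, hd⟩⟩
  obtain ⟨m, hm⟩ := exists_norm_eq (EuclideanSpace ℝ (Fin d)) (c := M) (by linarith)
  obtain ⟨Q, hQ, hball⟩ := exists_smoothDensityLaws_ball d hr
  have hQ' := map_add_right_mem_smoothDensityLaws hQ m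
  have := hQ.1
  have := hQ'.1
  -- The largest tilt that the `χ²` budget `a² ≤ 1/(4n)` permits.
  set a : ℝ := 1 / (2 * √n)
  have a0 : 0 ≤ a := by positivity
  have asq : a ^ 2 = 1 / (4 * n) := by
    simp only [a, div_pow, mul_pow, Real.sq_sqrt n0'.le]; norm_num
  have a1 : a ≤ 1 := by
    refine (sq_le_one_iff₀ a0).1 (asq.trans_le ?_)
    rw [div_le_one (by positivity)]
    have : (1 : ℝ) ≤ n := by exact_mod_cast n0
    linarith
  have := isProbabilityMeasure_binaryMixture (Q₀ := Q) (Q₁ := Q.map (· + m)) le_rfl zero_le_one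
  have := isProbabilityMeasure_binaryMixture (Q₀ := Q) (Q₁ := Q.map (· + m)) a0 a1
  refine one_fifth_le_minimaxProbability
    (binaryMixture_mem_smoothDensityLaws hQ hQ' le_rfl zero_le_one)
    (binaryMixture_mem_smoothDensityLaws hQ hQ' a0 a1) ?_ fun A hA =>
      pi_binaryMixture_le_add Metric.isOpen_ball.measurableSet hball ?_ a0 a1 n0 asq.le hA
  · have i₀ := integrable_featureMap ν hk Q
    have i₁ := integrable_featureMap ν hk (Q.map (· + m))
    have lower := le_norm_kernelMeanEmbedding_sub_map_sq hk hr hM h₁ h₀ hm hball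
    have e : kernelMeanEmbedding H (binaryMixture Q (Q.map (· + m)) 0) -
        kernelMeanEmbedding H (binaryMixture Q (Q.map (· + m)) a) =
        (-(a / 2)) • (kernelMeanEmbedding H Q - kernelMeanEmbedding H (Q.map (· + m))) := by
      simp only [kernelMeanEmbedding]
      rw [integral_binaryMixture i₀ i₁ le_rfl zero_le_one, integral_binaryMixture i₀ i₁ a0 a1]
      module
    refine (pow_le_pow_iff_left₀ (by positivity) (norm_nonneg _) two_ne_zero).1 ?_
    have b2 : 1 ≤ Real.exp 1 := Real.one_le_exp zero_le_one
    have b3 : 0 ≤ 1 - 2 / (2 + (d : ℝ)) := by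
      rw [sub_nonneg, div_le_one (by positivity)]; linarith [Nat.cast_nonneg (α := ℝ) d]
    have b4 : 1 - 2 / (2 + (d : ℝ)) ≤ 1 := by
      linarith [show 0 ≤ 2 / (2 + (d : ℝ)) by positivity]
    -- The factors `t₀/t₁`, `1/e` and `1 - 2/(2 + d)` are all at most `1`, so the squared radius may
    -- be compared with `β` alone.
    have b5 : β * t₀ / (t₁ * Real.exp 1) ≤ β := by
      rw [div_le_iff₀ (by positivity)]
      have : (t₀ : ℝ) ≤ t₁ := ht
      nlinarith [mul_le_mul this b2 zero_le_one p₁.le]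
    have b6 : β * t₀ / (t₁ * Real.exp 1) * (1 - 2 / (2 + (d : ℝ))) ≤ β := by
      have := mul_le_mul b5 b4 b3 hβ.le
      linarith
    rw [e, norm_smul, mul_pow, mul_pow, mul_pow, Real.sq_sqrt (by positivity), Real.norm_eq_abs,
      sq_abs, neg_sq, div_pow a, asq]
    calc (2 : ℝ) ^ 2 * ((1 / 50) ^ 2 *
          (1 / (2 * n) * (β * t₀ / (t₁ * Real.exp 1) * (1 - 2 / (2 + d)))))
        ≤ 2 ^ 2 * ((1 / 50) ^ 2 * (1 / (2 * n) * β)) := by gcongr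
      _ ≤ 1 / (4 * n) / 2 ^ 2 * (β / 2) := by
        field_simp
        norm_num
      _ ≤ _ := by
        gcongr
        linarith
  -- If `x` and `x + m` both lay in the ball, then `‖m‖ < 2r`, against `‖m‖ = M ≥ 4r`.
  · refine (ae_map_iff (measurable_add_const m).aemeasurable
      Metric.isOpen_ball.measurableSet.compl).2 (hball.mono fun x hx hxm => ?_)
    rw [mem_ball_zero_iff] at hx hxm
    have := norm_sub_le (x + m) x
    rw [add_sub_cancel_left, hm] at this
    linarith
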